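/- Let $\mathcal{G}=(\mathbb{V},\mathbb{E})$ be a finite strongly connected directed graph without loops, with $\mathbb{V}=\{1,\dots,m\}$ and $\mathbb{E}\subseteq\mathbb{V}\times\mathbb{V}$. Let $\mathbb{L}(\mathcal{G})$ be the set of weighted Laplacian matrices of $\mathcal{G}$, i.e. of all $L=(l_{ij})\in\mathbb{R}^{m\times m}$ such that, for all $i\neq j$, $l_{ji}=0$ if $(i,j)\notin\mathbb{E}$ and $l_{ji}<0$ if $(i,j)\in\mathbb{E}$, and $\sum_{j\in\mathbb{V}} l_{ij}=0$ for every $i\in\mathbb{V}$. Let $\pi:\mathbb{L}(\mathcal{G})\to\mathbb{R}_{<0}^{\mathbb{E}}$, $\pi(L)=(l_{ji})_{(i,j)\in\mathbb{E}}$, be the bijection that reads off the edge weights. Then almost all $L\in\mathbb{L}(\mathcal{G})$ satisfy both of the following properties, in the sense that the image under $\pi$ of the set of those $L\in\mathbb{L}(\mathcal{G})$ that violate (P1) or (P2) has Lebesgue measure zero in $\mathbb{R}^{\mathbb{E}}$: (P1) no right or left eigenvector of $L$ (in $\mathbb{C}^m$, for any complex eigenvalue) has a zero entry; (P2) every complex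 eigenvalue of $L$ is simple, i.e. has algebraic and geometric multiplicity one. -/

import Mathlib

open MeasureTheory

noncomputable section

namespace WLM

variable {V : Type*}

/-- A digraph is strongly connected if there is a directed path (possibly of length zero)
from every vertex to every vertex. -/
def StronglyConnected (G : Digraph V) : Prop :=
  ∀ i j : V, Relation.ReflTransGen G.Adj i j

/-- A digraph without loops. -/
def Loopless (G : Digraph V) : Prop :=
  ∀ i : V, ¬ G.Adj i i

/-- The edge set of a digraph, as a type. The edge `(i, j)` points from `i` to `j`. -/
abbrev Edge (G : Digraph V) : Type _ :=
  {e : V × V // G.Adj e.1 e.2}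

instance [Fintype V] (G : Digraph V) : Fintype (Edge G) :=
  Fintype.ofFinite _

/-- The set of real weighted Laplacian matrices of `G`. -/
def weightedLaplacians [Fintype V] (G : Digraph V) : Set (Matrix V V ℝ) :=
  {L | (∀ i j : V, j ≠ i → ¬ G.Adj i j → L j i = 0) ∧
    (∀ i j : V, j ≠ i → G.Adj i j → L j i < 0) ∧
    (∀ i : V, ∑ j, L i j = 0)}

/-- The vector of edge weights of a matrix: the coordinate of the edge `(i, j)` is the
`(j, i)` entry. -/
def edgeWeights (G : Digraph V) (L : Matrix V V ℝ) : Edge G → ℝ :=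
  fun e => L e.1.2 e.1.1

/-- For a loopless digraph, the edge weights identify the weighted Laplacian matrices with the
vectors in `ℝ^E` all of whose entries are negative. -/
theorem edgeWeights_bijOn [Fintype V] (G : Digraph V) (hG : Loopless G) :
    Set.BijOn (edgeWeights G) (weightedLaplacians G) {w | ∀ e, w e < 0} := by
  classical
  have hne : ∀ i j, G.Adj i j → j ≠ i := fun i j h e => hG i (by rw [e] at h; exact h)
  refine ⟨fun L hL e => hL.2.1 _ _ (hne _ _ e.2) e.2, ?_, ?_⟩
  · intro L hL L' hL' h
    have hoff : ∀ i j, j ≠ i → L j i = L' j i := by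
      intro i j hij
      by_cases hA : G.Adj i j
      · exact congrFun h ⟨(i, j), hA⟩
      · rw [hL.1 i j hij hA, hL'.1 i j hij hA]
    ext i j
    by_cases hij : i = j
    · subst hij
      have h1 := hL.2.2 i
      have h2 := hL'.2.2 i
      rw [← Finset.add_sum_erase _ _ (Finset.mem_univ i)] at h1 h2
      have h3 : ∑ x ∈ Finset.univ.erase i, L i x = ∑ x ∈ Finset.univ.erase i, L' i x :=
        Finset.sum_congr rfl fun x hx => hoff x i (Finset.ne_of_mem_erase hx).symm
      linarith
    · exact hoff j i hij
  · intro w hw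
    let f : V → V → ℝ := fun i j => if h : G.Adj j i then w ⟨(j, i), h⟩ else 0
    have hf : ∀ i j, i ≠ j →
        (Matrix.of f - Matrix.diagonal fun i => ∑ k, f i k) i j = f i j := by
      intro i j hij
      simp [Matrix.diagonal_apply_ne _ hij]
    refine ⟨Matrix.of f - Matrix.diagonal (fun i => ∑ k, f i k), ⟨?_, ?_, ?_⟩, ?_⟩
    · intro i j hij hA
      rw [hf j i hij]
      simp [f, hA]
    · intro i j hij hA
      rw [hf j i hij]
      simpa [f, hA] using hw ⟨(i, j), hA⟩
    · intro i
      simp [Matrix.sub_apply, Matrix.diagonal_apply, Finset.sum_sub_distrib]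
    · funext e
      have he := hf e.1.2 e.1.1 (hne _ _ e.2)
      rw [edgeWeights, he]
      simp [f, e.2]

/-- `P` holds for almost all weighted Laplacian matrices of `G`: the edge-weight vectors of the
exceptional matrices form a Lebesgue null set in `ℝ^E`. -/
def AlmostAll [Fintype V] (G : Digraph V) (P : Matrix V V ℝ → Prop) : Prop :=
  volume (edgeWeights G '' {L | L ∈ weightedLaplacians G ∧ ¬ P L}) = 0

/-- No complex right eigenvector and no complex left eigenvector of the real matrix `L` has a
zero entry. -/
def EigenvectorsNoZeroEntry [Fintype V] (L : Matrix V V ℝ) : Prop :=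
  (∀ (μ : ℂ) (v : V → ℂ),
    Module.End.HasEigenvector (L.map Complex.ofReal).mulVecLin μ v → ∀ i, v i ≠ 0) ∧
  (∀ (μ : ℂ) (v : V → ℂ),
    Module.End.HasEigenvector (L.map Complex.ofReal).vecMulLinear μ v → ∀ i, v i ≠ 0)

/-- Every complex eigenvalue of the real matrix `L` has algebraic and geometric
multiplicity one. -/
def EigenvaluesSimple [Fintype V] [DecidableEq V] (L : Matrix V V ℝ) : Prop :=
  ∀ μ : ℂ, Module.End.HasEigenvalue (L.map Complex.ofReal).mulVecLin μ →
    (L.map Complex.ofReal).charpoly.rootMultiplicity μ = 1 ∧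
    Module.finrank ℂ (Module.End.eigenspace (L.map Complex.ofReal).mulVecLin μ) = 1

end WLM

end

/-! Treat the edge weights as indeterminates and let χ be the characteristic polynomial of the
generic Laplacian, χ_T that of its principal submatrix with rows and columns in T deleted. An
eigenvector with i-th entry zero forces a common root of χ and χ_{i}, so it suffices that χ is
separable and coprime to every χ_{i} after specialization. Generically these are Bézout identities
with right-hand side a nonzero polynomial c in the weights, and they survive wherever c does not
vanish, that is, off a null set.

The generic statement rests on `dvd_X_pow_or_dvd_X_pow`. Since χ has degree at most one in the
weights of each row, a factorization χ = g h splits the rows into a set T absent from g and a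
complement absent from h. Setting rows to zero then yields χ = χ_T χ_{Tᶜ} if both sets are nonempty.
This is impossible at X = 0: the Laplacian is singular, but by strong connectivity and the maximum
principle its proper principal minors are not zero. Gauss's lemma moves the result to the fraction
field. -/

/-! ### Zero sets of real polynomials -/

/-- The zero set of a nonzero real polynomial in finitely many variables is a Lebesgue null set. -/
theorem MvPolynomial.volume_setOf_eval_eq_zero_fin {n : ℕ} (p : MvPolynomial (Fin n) ℝ)
    (hp : p ≠ 0) : volume {x : Fin n → ℝ | MvPolynomial.eval x p = 0} = 0 := by
  induction n with
  | zero =>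
    have h : {x : Fin 0 → ℝ | MvPolynomial.eval x p = 0} = ∅ := by
      ext x
      simp only [Set.mem_ofPred_eq, Set.mem_empty_iff_false, iff_false]
      intro hx
      apply hp
      apply MvPolynomial.funext
      intro y
      rw [Subsingleton.elim y x, hx, map_zero]
    rw [h, measure_empty]
  | succ n ih =>
    let e := MeasurableEquiv.piFinSuccAbove (fun _ : Fin (n + 1) => ℝ) 0
    have he : MeasurePreserving e volume volume :=
      volume_preserving_piFinSuccAbove (fun _ : Fin (n + 1) => ℝ) 0
    let f := MvPolynomial.finSuccEquiv ℝ n p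
    have hf : f ≠ 0 := by simpa [f] using hp
    let S : Set (ℝ × (Fin n → ℝ)) := {z | MvPolynomial.eval (Fin.cons z.1 z.2) p = 0}
    have hcont : Continuous fun z : ℝ × (Fin n → ℝ) =>
        MvPolynomial.eval (Fin.cons z.1 z.2 : Fin (n + 1) → ℝ) p :=
      (MvPolynomial.continuous_eval p).comp
        (continuous_pi fun i => by
          refine Fin.cases ?_ (fun k => ?_) i
          · simpa using continuous_fst
          · exact (continuous_apply k).comp continuous_snd)
    have hS : MeasurableSet S := (isClosed_singleton.preimage hcont).measurableSet
    have hpre : {x : Fin (n + 1) → ℝ | MvPolynomial.eval x p = 0} = e ⁻¹' S := by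
      ext x
      have : (Fin.cons (e x).1 (e x).2 : Fin (n + 1) → ℝ) = x := by
        exact Fin.cons_self_tail x
      simp only [Set.mem_ofPred_eq, Set.mem_preimage, S, this]
    rw [hpre, he.measure_preimage hS.nullMeasurableSet, Measure.volume_eq_prod,
      Measure.measure_prod_null hS]
    -- By Fubini almost every slice must be null. Only finitely many values of the first variable
    -- turn `p` into the zero polynomial in the others; elsewhere induction applies.
    have hfin : {t : ℝ | Polynomial.eval (MvPolynomial.C t) f = 0}.Finite := by
      refine Set.Finite.of_finite_image
        (Set.Finite.subset (Polynomial.finite_setOfPred_isRoot hf) ?_)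
        (MvPolynomial.C_injective (Fin n) ℝ).injOn
      rintro _ ⟨t, ht, rfl⟩
      exact ht
    have hae : ∀ᵐ t : ℝ, Polynomial.eval (MvPolynomial.C t) f ≠ 0 :=
      measure_mono_null (fun t ht => by simpa using ht) (hfin.measure_zero volume)
    filter_upwards [hae] with t ht
    have hz := ih _ ht
    refine measure_mono_null (fun y hy => ?_) hz
    have hy' : MvPolynomial.eval (Fin.cons t y) p = 0 := hy
    rw [MvPolynomial.eval_eq_eval_mv_eval'] at hy'
    rw [Set.mem_ofPred_eq, ← hy', Polynomial.eval_map, Polynomial.eval, Polynomial.hom_eval₂]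
    simp [f]

theorem MvPolynomial.volume_setOf_eval_eq_zero {ι : Type*} [Fintype ι] (p : MvPolynomial ι ℝ)
    (hp : p ≠ 0) : volume {x : ι → ℝ | MvPolynomial.eval x p = 0} = 0 := by
  let e := Fintype.equivFin ι
  let E := MeasurableEquiv.piCongrLeft (fun _ : Fin (Fintype.card ι) => ℝ) e
  have hE : MeasurePreserving E volume volume :=
    volume_measurePreserving_piCongrLeft (fun _ : Fin (Fintype.card ι) => ℝ) e
  have hq : MvPolynomial.rename e p ≠ 0 := by
    simpa using (MvPolynomial.rename_injective e e.injective).ne hp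
  have h := MvPolynomial.volume_setOf_eval_eq_zero_fin _ hq
  rw [← hE.measure_preimage_equiv] at h
  convert h using 2
  ext x
  have : (E x) ∘ e = x := by
    funext i
    exact Equiv.piCongrLeft_apply_apply (fun _ : Fin (Fintype.card ι) => ℝ) e x i
  simp [MvPolynomial.eval_rename, this]

/-! ### Gauss's lemma and Bézout identities without denominators -/

namespace Polynomial

variable {R : Type*} [CommRing R] [IsDomain R]

/-- Clearing denominators in a Bézout identity over the fraction field. -/
theorem exists_mul_add_mul_eq_C_of_isCoprime_map {p q : R[X]}
    (h : IsCoprime (p.map (algebraMap R (FractionRing R))) (q.map (algebraMap R (FractionRing R)))) :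
    ∃ (a b : R[X]) (c : R), c ≠ 0 ∧ a * p + b * q = C c := by
  obtain ⟨a, b, hab⟩ := h
  obtain ⟨s, hs0, hs⟩ := IsLocalization.integerNormalization_spec (nonZeroDivisors R) a
  obtain ⟨t, ht0, ht⟩ := IsLocalization.integerNormalization_spec (nonZeroDivisors R) b
  refine ⟨C t * IsLocalization.integerNormalization (nonZeroDivisors R) a,
    C s * IsLocalization.integerNormalization (nonZeroDivisors R) b, s * t,
    mul_ne_zero (nonZeroDivisors.ne_zero hs0) (nonZeroDivisors.ne_zero ht0), ?_⟩
  apply Polynomial.map_injective _ (IsFractionRing.injective R (FractionRing R))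
  simp only [Polynomial.map_add, Polynomial.map_mul, hs, ht, map_C, Algebra.smul_def,
    IsScalarTower.algebraMap_apply R (FractionRing R) (FractionRing R)[X], algebraMap_eq, map_mul]
  linear_combination (C (algebraMap R (FractionRing R) s) * C (algebraMap R (FractionRing R) t)) * hab

variable [IsIntegrallyClosed R]

/-- Gauss's lemma: integral closedness keeps the normalized factors of a monic polynomial inside
`R[X]`. Squarefreeness and coprimality over the fraction field can therefore be tested on monic
divisors over `R`. -/
theorem exists_monic_of_dvd_map {p : R[X]} (hp : p.Monic) {f : (FractionRing R)[X]}
    (hf : f ∣ p.map (algebraMap R (FractionRing R))) :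
    ∃ g : R[X], g.Monic ∧ Associated (g.map (algebraMap R (FractionRing R))) f := by
  obtain ⟨g, hg⟩ := IsIntegrallyClosed.eq_map_mul_C_of_dvd (FractionRing R) hp hf
  have hf0 : f ≠ 0 := ne_zero_of_dvd_ne_zero (hp.map _).ne_zero hf
  have hlc : f.leadingCoeff ≠ 0 := leadingCoeff_ne_zero.2 hf0
  refine ⟨g, ?_, ?_⟩
  · have h1 : (g.map (algebraMap R (FractionRing R))).leadingCoeff = 1 := by
      have := congrArg leadingCoeff hg
      rw [leadingCoeff_mul, leadingCoeff_C] at this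
      exact mul_right_cancel₀ hlc (by rw [this, one_mul])
    rw [leadingCoeff_map_of_injective (IsFractionRing.injective R (FractionRing R))] at h1
    exact IsFractionRing.injective R (FractionRing R) (by rw [h1, map_one])
  · refine ⟨(isUnit_C.2 hlc.isUnit).unit, ?_⟩
    simpa using hg

theorem isCoprime_map_of_forall_monic {p q : R[X]} (hp : p.Monic)
    (h : ∀ g : R[X], g.Monic → g ∣ p → g ∣ q → g = 1) :
    IsCoprime (p.map (algebraMap R (FractionRing R))) (q.map (algebraMap R (FractionRing R))) := by
  have hinj := IsFractionRing.injective R (FractionRing R)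
  refine isCoprime_of_dvd _ _ (fun h0 => (hp.map (algebraMap R (FractionRing R))).ne_zero h0.1) ?_
  intro f hfu _ hfp hfq
  obtain ⟨g, hg, hgf⟩ := exists_monic_of_dvd_map hp hfp
  have : g = 1 := h g hg ((map_dvd_map _ hinj hg).1 (hgf.dvd.trans hfp))
    ((map_dvd_map _ hinj hg).1 (hgf.dvd.trans hfq))
  subst this
  apply hfu
  simpa using (hgf.isUnit_iff).1 (by simp)

theorem separable_map_of_forall_monic [CharZero R] {p : R[X]} (hp : p.Monic)
    (h : ∀ g : R[X], g.Monic → g * g ∣ p → g = 1) :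
    (p.map (algebraMap R (FractionRing R))).Separable := by
  have hinj := IsFractionRing.injective R (FractionRing R)
  have : CharZero (FractionRing R) := charZero_of_injective_algebraMap hinj
  rw [PerfectField.separable_iff_squarefree]
  intro f hf
  obtain ⟨g, hg, hgf⟩ := exists_monic_of_dvd_map hp ((dvd_mul_right f f).trans hf)
  have : g = 1 := h g hg ((map_dvd_map _ hinj (hg.mul hg)).1 (by
    rw [Polynomial.map_mul]; exact (mul_dvd_mul hgf.dvd hgf.dvd).trans hf))
  subst this
  exact (hgf.isUnit_iff).1 (by simp)

end Polynomial

noncomputable section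
namespace WLM

open Polynomial

/-! ### Maximum principle and principal minors -/

section Real

variable {V : Type*} [Fintype V]

/-- A vector annihilated by the rows outside `T` of a weighted Laplacian and vanishing on `T`
has no positive entry. -/
theorem nonpos_of_mulVec_eq_zero_of_eq_zero {G : Digraph V} (hconn : StronglyConnected G)
    {L : Matrix V V ℝ} (hL : L ∈ weightedLaplacians G) {T : Finset V} (hT : T.Nonempty)
    {v : V → ℝ} (hv : ∀ j ∉ T, ∑ k, L j k * v k = 0) (hvT : ∀ j ∈ T, v j = 0) (j : V) :
    v j ≤ 0 := by
  by_contra! hpos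
  obtain ⟨m, -, hm⟩ := Finset.exists_max_image Finset.univ v ⟨j, Finset.mem_univ j⟩
  have hmpos : 0 < v m := hpos.trans_le (hm j (Finset.mem_univ j))
  -- At a maximum outside `T` the zero row sum makes terms of one sign add up to zero, so the
  -- maximum passes backwards along every edge, eventually reaching `T`, where `v` vanishes.
  have key : ∀ i k, G.Adj i k → v k = v m → v i = v m := by
    intro i k hik hk
    by_contra hne
    have hki : k ≠ i := fun h => hne (h ▸ hk)
    have hkT : k ∉ T := fun h => by rw [hvT k h] at hk; exact hmpos.ne hk
    have h1 : ∑ l, L k l * (v m - v l) = 0 := by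
      have h2 := hL.2.2 k
      simp only [mul_sub, Finset.sum_sub_distrib, hv k hkT, ← Finset.sum_mul, h2, zero_mul,
        sub_zero]
    have hle : ∀ l ∈ Finset.univ, L k l * (v m - v l) ≤ 0 := by
      intro l _
      by_cases hkl : k = l
      · subst hkl
        simp [hk]
      · refine mul_nonpos_of_nonpos_of_nonneg ?_ (sub_nonneg.2 (hm l (Finset.mem_univ l)))
        by_cases hA : G.Adj l k
        · exact (hL.2.1 l k hkl hA).le
        · exact (hL.1 l k hkl hA).le
    have h3 := (Finset.sum_eq_zero_iff_of_nonpos hle).1 h1 i (Finset.mem_univ i)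
    rcases mul_eq_zero.1 h3 with h | h
    · exact (hL.2.1 i k hki hik).ne h
    · exact hne (by linarith)
  obtain ⟨t, ht⟩ := hT
  have : ∀ i, Relation.ReflTransGen G.Adj i m → v i = v m := by
    intro i hi
    induction hi using Relation.ReflTransGen.head_induction_on with
    | refl => rfl
    | head h _ ih => exact key _ _ h ih
  exact hmpos.ne' ((this t (hconn t m)).symm.trans (hvT t ht))

/-- A kernel vector, extended by zero on `T`, obeys the maximum principle together with its
negative, so it vanishes. -/
theorem det_submatrix_compl_ne_zero [DecidableEq V] {G : Digraph V}
    (hconn : StronglyConnected G) {L : Matrix V V ℝ} (hL : L ∈ weightedLaplacians G)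
    {T : Finset V} (hT : T.Nonempty) :
    (L.submatrix (Subtype.val : {j // j ∉ T} → V) Subtype.val).det ≠ 0 := by
  intro hdet
  obtain ⟨u, hu0, hu⟩ := Matrix.exists_mulVec_eq_zero_iff.2 hdet
  let v : V → ℝ := fun j => if h : j ∉ T then u ⟨j, h⟩ else 0
  have hvT : ∀ j ∈ T, v j = 0 := fun j hj => by simp [v, hj]
  have hv : ∀ j ∉ T, ∑ k, L j k * v k = 0 := by
    intro j hj
    have h1 := congrFun hu ⟨j, hj⟩
    simp only [Matrix.mulVec, dotProduct, Matrix.submatrix_apply, Pi.zero_apply] at h1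
    rw [← h1, ← Fintype.sum_subtype_add_sum_subtype (fun k => k ∉ T), add_eq_left.2]
    · exact Finset.sum_congr rfl fun k _ => by simp [v, k.2]
    · exact Finset.sum_eq_zero fun k _ => by rw [hvT k (not_not.1 k.2), mul_zero]
  apply hu0
  funext j
  have h1 := nonpos_of_mulVec_eq_zero_of_eq_zero hconn hL hT hv hvT j
  have h2 := nonpos_of_mulVec_eq_zero_of_eq_zero (v := fun k => -v k) hconn hL hT
    (fun k hk => by simp [hv k hk]) (fun k hk => by simp [hvT k hk]) j
  have h3 : v j = u j := by simp [v, j.2]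
  rw [← h3, Pi.zero_apply]
  linarith

end Real

/-! ### Characteristic polynomial of a matrix with zero rows -/

section Charpoly

variable {V R : Type*} [Fintype V] [DecidableEq V] [CommRing R]

theorem charpoly_eq_X_pow_mul_of_rows_eq_zero (N : Matrix V V R) (T : Finset V)
    (h : ∀ i ∈ T, ∀ j, N i j = 0) :
    N.charpoly = X ^ T.card *
      (N.submatrix (Subtype.val : {j // j ∉ T} → V) Subtype.val).charpoly := by
  have hzero : ∀ i, ¬ i ∉ T → ∀ j, j ∉ T → N.charmatrix i j = 0 := by
    intro i hi j hj
    have hij : i ≠ j := fun hij => hi (hij ▸ hj)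
    rw [Matrix.charmatrix_apply_ne _ _ _ hij, h i (not_not.1 hi), C_0, neg_zero]
  rw [Matrix.charpoly, Matrix.twoBlockTriangular_det _ (fun j => j ∉ T) hzero, mul_comm]
  congr 1
  · have : N.charmatrix.toSquareBlockProp (fun i => ¬ i ∉ T) = Matrix.diagonal fun _ => X := by
      ext i j : 2
      rw [Matrix.toSquareBlockProp_def, Matrix.of_apply, Matrix.charmatrix_apply,
        h _ (not_not.1 i.2), C_0, sub_zero]
      simp [Matrix.diagonal_apply, Subtype.ext_iff]
    rw [this, Matrix.det_diagonal, Finset.prod_const, Finset.card_univ]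
    congr 1
    rw [Fintype.card_subtype]
    simp
  · rw [Matrix.charpoly]
    congr 1
    ext i j : 2
    simp [Matrix.toSquareBlockProp_def, Matrix.charmatrix_apply, Matrix.diagonal_apply,
      Subtype.ext_iff]

end Charpoly

/-! ### The generic Laplacian and row substitutions -/

variable {V : Type*} [Fintype V] [DecidableEq V] (G : Digraph V)

/-- The generic off-diagonal part of a weighted Laplacian. -/
def genericWeight (j k : V) : MvPolynomial (Edge G) ℝ :=
  open Classical in if h : G.Adj k j then MvPolynomial.X ⟨(k, j), h⟩ else 0

/-- The generic weighted Laplacian, with the edge weights as indeterminates. -/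
def genericLaplacian : Matrix V V (MvPolynomial (Edge G) ℝ) :=
  Matrix.of (genericWeight G) - Matrix.diagonal fun j => ∑ k, genericWeight G j k

variable {G}

/-- Row `j` consists of linear forms in the weights of the edges entering `j`. This covers both
zeroing and scaling of rows. -/
theorem map_genericLaplacian_of_map_X {S : Type*} [CommRing S]
    (φ ψ : MvPolynomial (Edge G) ℝ →+* S) (c : V → S)
    (h : ∀ e : Edge G, φ (MvPolynomial.X e) = c e.1.2 * ψ (MvPolynomial.X e)) (j k : V) :
    φ (genericLaplacian G j k) = c j * ψ (genericLaplacian G j k) := by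
  have hw : ∀ k, φ (genericWeight G j k) = c j * ψ (genericWeight G j k) := by
    intro k
    unfold genericWeight
    split_ifs with hA
    · exact h ⟨(k, j), hA⟩
    · simp
  simp only [genericLaplacian, Matrix.sub_apply, Matrix.of_apply, Matrix.diagonal_apply, map_sub,
    mul_sub, hw]
  congr 1
  split_ifs
  · simp [hw, Finset.mul_sum]
  · simp

theorem sum_genericLaplacian (j : V) : ∑ k, genericLaplacian G j k = 0 := by
  simp [genericLaplacian, Matrix.diagonal_apply, Finset.sum_sub_distrib]

theorem genericLaplacian_map_eval (hG : Loopless G) {L : Matrix V V ℝ}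
    (hL : L ∈ weightedLaplacians G) :
    (genericLaplacian G).map (MvPolynomial.eval (edgeWeights G L)) = L := by
  have hoff : ∀ j k, j ≠ k → (genericWeight G j k).eval (edgeWeights G L) = L j k := by
    intro j k hjk
    unfold genericWeight
    split_ifs with hA
    · simp [edgeWeights]
    · simpa using (hL.1 k j hjk hA).symm
  have hdiag : ∀ j, genericWeight G j j = 0 := fun j => dif_neg (hG j)
  ext j k
  by_cases hjk : j = k
  · subst hjk
    have h1 := hL.2.2 j
    rw [← Finset.add_sum_erase _ _ (Finset.mem_univ j)] at h1
    have h2 : ∑ k, (genericWeight G j k).eval (edgeWeights G L) =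
        ∑ k ∈ Finset.univ.erase j, L j k := by
      rw [← Finset.add_sum_erase _ _ (Finset.mem_univ j), hdiag, map_zero, zero_add]
      exact Finset.sum_congr rfl fun k hk => hoff j k (Finset.ne_of_mem_erase hk).symm
    simp only [genericLaplacian, Matrix.map_apply, Matrix.sub_apply, Matrix.of_apply,
      Matrix.diagonal_apply_eq, map_sub, map_sum, h2, hdiag, map_zero]
    linarith
  · simp [genericLaplacian, Matrix.diagonal_apply_ne _ hjk, hoff j k hjk]

/-- The substitution that sets the weights in the rows indexed by `T` to zero. -/
def zeroRows (T : Finset V) : MvPolynomial (Edge G) ℝ →+* MvPolynomial (Edge G) ℝ :=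
  MvPolynomial.eval₂Hom MvPolynomial.C fun e => if e.1.2 ∈ T then 0 else MvPolynomial.X e

theorem zeroRows_genericLaplacian (T : Finset V) (j k : V) :
    zeroRows T (genericLaplacian G j k) = if j ∈ T then 0 else genericLaplacian G j k := by
  have := map_genericLaplacian_of_map_X (zeroRows (G := G) T) (RingHom.id _)
    (fun j => if j ∈ T then 0 else 1) (fun e => by simp [zeroRows]) j k
  simpa using this

omit [Fintype V] in
theorem zeroRows_comp_zeroRows (S T : Finset V) :
    (zeroRows (G := G) S).comp (zeroRows T) = zeroRows (S ∪ T) := by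
  refine MvPolynomial.ringHom_ext (fun r => by simp [zeroRows]) fun e => ?_
  by_cases hS : e.1.2 ∈ S <;> by_cases hT : e.1.2 ∈ T <;> simp [zeroRows, hS, hT]

/-- Coefficientwise application of `zeroRows`. -/
abbrev mapZeroRows (T : Finset V) : (MvPolynomial (Edge G) ℝ)[X] →+* (MvPolynomial (Edge G) ℝ)[X] :=
  mapRingHom (zeroRows T)

omit [Fintype V] in
theorem mapZeroRows_mapZeroRows (S T : Finset V) (g : (MvPolynomial (Edge G) ℝ)[X]) :
    mapZeroRows S (mapZeroRows T g) = mapZeroRows (S ∪ T) g := by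
  simp only [mapZeroRows, coe_mapRingHom, Polynomial.map_map, zeroRows_comp_zeroRows]

omit [Fintype V] in
theorem mapZeroRows_empty (g : (MvPolynomial (Edge G) ℝ)[X]) : mapZeroRows ∅ g = g := by
  have : zeroRows (G := G) ∅ = RingHom.id _ :=
    MvPolynomial.ringHom_ext (fun r => by simp [zeroRows]) fun e => by simp [zeroRows]
  rw [mapZeroRows, this]
  simp

omit [Fintype V] in
theorem mapZeroRows_eq_self {T : Finset V} {g : (MvPolynomial (Edge G) ℝ)[X]}
    (h : ∀ j ∈ T, mapZeroRows {j} g = g) : mapZeroRows T g = g := by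
  induction T using Finset.induction_on with
  | empty => exact mapZeroRows_empty g
  | insert a s _ ih =>
    rw [Finset.insert_eq, ← mapZeroRows_mapZeroRows,
      ih fun j hj => h j (Finset.mem_insert_of_mem hj), h a (Finset.mem_insert_self a s)]

/-- The characteristic polynomial of the principal submatrix of the generic Laplacian obtained by
deleting the rows and columns in `T`. -/
def principalCharpoly (G : Digraph V) (T : Finset V) : (MvPolynomial (Edge G) ℝ)[X] :=
  ((genericLaplacian G).submatrix (Subtype.val : {j // j ∉ T} → V) Subtype.val).charpoly

theorem principalCharpoly_monic (T : Finset V) : (principalCharpoly G T).Monic :=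
  Matrix.charpoly_monic _

theorem mapZeroRows_charpoly (T : Finset V) :
    mapZeroRows T (genericLaplacian G).charpoly = X ^ T.card * principalCharpoly G T := by
  rw [mapZeroRows, coe_mapRingHom, ← Matrix.charpoly_map,
    charpoly_eq_X_pow_mul_of_rows_eq_zero _ T, principalCharpoly]
  · congr 2
    ext i j : 2
    simp [zeroRows_genericLaplacian, i.2]
  · intro i hi j
    simp [zeroRows_genericLaplacian, hi]

theorem eval_zero_principalCharpoly_ne_zero (hG : Loopless G) (hconn : StronglyConnected G)
    {T : Finset V} (hT : T.Nonempty) : (principalCharpoly G T).eval 0 ≠ 0 := by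
  -- Nonvanishing needs only one specialization; all weights equal to -1 will do.
  obtain ⟨L, hL, -⟩ := (edgeWeights_bijOn G hG).surjOn
    (show (fun _ => -1 : Edge G → ℝ) ∈ {w : Edge G → ℝ | ∀ e, w e < 0} from fun _ => by norm_num)
  intro h0
  apply det_submatrix_compl_ne_zero hconn hL hT
  rw [principalCharpoly, Matrix.eval_charpoly] at h0
  have h1 := congrArg (MvPolynomial.eval (edgeWeights G L)) h0
  rw [RingHom.map_det, (MvPolynomial.eval (edgeWeights G L)).map_zero] at h1
  have h2 : (MvPolynomial.eval (edgeWeights G L)).mapMatrix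
      (Matrix.scalar _ 0 - (genericLaplacian G).submatrix
        (Subtype.val : {j // j ∉ T} → V) Subtype.val) =
      -(L.submatrix (Subtype.val : {j // j ∉ T} → V) Subtype.val) := by
    ext i j
    have := congrFun (congrFun (genericLaplacian_map_eval hG hL) i.1) j.1
    simpa using this
  rw [h2, Matrix.det_neg] at h1
  exact (mul_eq_zero.1 h1).resolve_left (by simp)

theorem eval_zero_charpoly_genericLaplacian [Nonempty V] :
    (genericLaplacian G).charpoly.eval 0 = 0 := by
  rw [Matrix.eval_charpoly, ← Matrix.exists_mulVec_eq_zero_iff]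
  refine ⟨fun _ => 1, fun h => one_ne_zero (congrFun h (Classical.arbitrary V)), ?_⟩
  funext j
  simpa [Matrix.mulVec, dotProduct, Matrix.sub_apply] using sum_genericLaplacian j

/-! ### Degree in the weights of one row -/

/-- The substitution that scales the weights in row `j` by a new indeterminate. -/
def scaleRow (j : V) : (MvPolynomial (Edge G) ℝ)[X] →+* (MvPolynomial (Edge G) ℝ)[X][X] :=
  eval₂RingHom (S := (MvPolynomial (Edge G) ℝ)[X][X])
    (MvPolynomial.eval₂Hom (S₁ := (MvPolynomial (Edge G) ℝ)[X][X])
      ((C.comp C).comp MvPolynomial.C)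
      fun e => (if e.1.2 = j then X else 1) * C (C (MvPolynomial.X e))) (C X)

omit [Fintype V] in
theorem eval_one_scaleRow (j : V) (g : (MvPolynomial (Edge G) ℝ)[X]) :
    (scaleRow j g).eval 1 = g := by
  have : (evalRingHom 1).comp (scaleRow j) = RingHom.id (MvPolynomial (Edge G) ℝ)[X] := by
    ext e
    · simp [scaleRow]
    · by_cases h : e.1.2 = j <;> simp [scaleRow, h]
    · simp [scaleRow]
  exact RingHom.congr_fun this g

omit [Fintype V] in
theorem eval_zero_scaleRow (j : V) (g : (MvPolynomial (Edge G) ℝ)[X]) :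
    (scaleRow j g).eval 0 = mapZeroRows {j} g := by
  have : (evalRingHom 0).comp (scaleRow j) = mapZeroRows (G := G) {j} := by
    ext e
    · simp [scaleRow, zeroRows]
    · by_cases h : e.1.2 = j <;> simp [scaleRow, h, zeroRows]
    · simp [scaleRow]
  exact RingHom.congr_fun this g

omit [Fintype V] in
-- A polynomial constant in the scaling variable has the same value at 0 and at 1.
theorem mapZeroRows_eq_self_of_natDegree_scaleRow {j : V} {g : (MvPolynomial (Edge G) ℝ)[X]}
    (h : (scaleRow j g).natDegree = 0) : mapZeroRows {j} g = g := by
  rw [← eval_zero_scaleRow]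
  conv_rhs => rw [← eval_one_scaleRow j g]
  rw [eq_C_of_natDegree_eq_zero h, eval_C, eval_C]

omit [Fintype V] in
theorem scaleRow_ne_zero {j : V} {g : (MvPolynomial (Edge G) ℝ)[X]} (hg : g ≠ 0) :
    scaleRow j g ≠ 0 := fun h => hg (by rw [← eval_one_scaleRow j g, h, eval_zero])

/-- The scaling variable enters the characteristic matrix only in row `j`, as `u + t v`, and the
determinant is linear in that row. -/
theorem natDegree_scaleRow_charpoly_le (j : V) :
    (scaleRow j (genericLaplacian G).charpoly).natDegree ≤ 1 := by
  let N := (genericLaplacian G).charmatrix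
  let u : V → (MvPolynomial (Edge G) ℝ)[X] := fun k => if j = k then X else 0
  let v : V → (MvPolynomial (Edge G) ℝ)[X] := fun k => -C (genericLaplacian G j k)
  have hC : ∀ w : V → (MvPolynomial (Edge G) ℝ)[X],
      ((N.map C).updateRow j fun k => C (w k)).det = C (N.updateRow j w).det := by
    intro w
    rw [RingHom.map_det]
    congr 1
    ext a b : 2
    by_cases ha : a = j
    · subst ha; simp
    · simp [Matrix.updateRow_ne ha]
  have hmat : (scaleRow j).mapMatrix N =
      (N.map C).updateRow j ((fun k => C (u k)) + (X : (MvPolynomial (Edge G) ℝ)[X][X]) •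
        fun k => C (v k)) := by
    ext a b : 1
    have hent := map_genericLaplacian_of_map_X (S := (MvPolynomial (Edge G) ℝ)[X][X])
      ((scaleRow (G := G) j).comp C) (C.comp C) (fun a => if a = j then X else 1) (fun e => by simp [scaleRow]) a b
    have hX : scaleRow (G := G) j X = C X := by simp [scaleRow]
    simp only [RingHom.comp_apply] at hent
    by_cases ha : a = j
    · subst ha
      by_cases hab : a = b
      · subst hab
        simp [N, u, v, hent, hX, sub_eq_add_neg]
        ring
      · simp [N, u, v, hent, hab, Matrix.charmatrix_apply_ne]
        ring
    · by_cases hab : a = b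
      · subst hab
        simp [N, hent, hX, ha]
      · simp [N, hent, hab, ha, Matrix.charmatrix_apply_ne]
  have hdet : scaleRow j N.det = ((scaleRow j).mapMatrix N).det :=
    RingHom.map_det (R := (MvPolynomial (Edge G) ℝ)[X]) (S := (MvPolynomial (Edge G) ℝ)[X][X])
      (scaleRow j) N
  rw [Matrix.charpoly, hdet, hmat, Matrix.det_updateRow_add, Matrix.det_updateRow_smul,
    hC, hC]
  refine (natDegree_add_le _ _).trans (max_le (by simp) ?_)
  exact (natDegree_mul_C_le _ _).trans natDegree_X_le

/-- In a factorization of the characteristic polynomial of the generic Laplacian, each row occurs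
in at most one factor. -/
theorem mapZeroRows_eq_self_or {g h : (MvPolynomial (Edge G) ℝ)[X]}
    (hgh : (genericLaplacian G).charpoly = g * h) (j : V) :
    mapZeroRows {j} g = g ∨ mapZeroRows {j} h = h := by
  have hne : g * h ≠ 0 := hgh ▸ (Matrix.charpoly_monic _).ne_zero
  have hd := natDegree_scaleRow_charpoly_le (G := G) j
  rw [hgh, map_mul, natDegree_mul (scaleRow_ne_zero (left_ne_zero_of_mul hne))
    (scaleRow_ne_zero (right_ne_zero_of_mul hne))] at hd
  rcases Nat.eq_zero_or_pos (scaleRow j g).natDegree with h0 | h0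
  · exact Or.inl (mapZeroRows_eq_self_of_natDegree_scaleRow h0)
  · exact Or.inr (mapZeroRows_eq_self_of_natDegree_scaleRow (by omega))

theorem mapZeroRows_univ_charpoly :
    mapZeroRows Finset.univ (genericLaplacian G).charpoly = X ^ Fintype.card V := by
  rw [mapZeroRows_charpoly, principalCharpoly]
  have : IsEmpty {j : V // j ∉ Finset.univ} := ⟨fun j => j.2 (Finset.mem_univ _)⟩
  rw [Matrix.charpoly, Matrix.det_isEmpty, mul_one, Finset.card_univ]

/-! ### Factorization of the generic characteristic polynomial -/

/-- The characteristic polynomial of the generic Laplacian of a strongly connected digraph is a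
power of `X` times an irreducible polynomial. -/
theorem dvd_X_pow_or_dvd_X_pow (hG : Loopless G) (hconn : StronglyConnected G) [Nonempty V]
    {g h : (MvPolynomial (Edge G) ℝ)[X]} (hgh : (genericLaplacian G).charpoly = g * h) :
    g ∣ X ^ Fintype.card V ∨ h ∣ X ^ Fintype.card V := by
  classical
  let T : Finset V := Finset.univ.filter fun j => mapZeroRows {j} g = g
  have hgT : mapZeroRows T g = g := mapZeroRows_eq_self fun j hj => (Finset.mem_filter.1 hj).2
  have hhT : mapZeroRows Tᶜ h = h := mapZeroRows_eq_self fun j hj =>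
    (mapZeroRows_eq_self_or hgh j).resolve_left fun h1 =>
      Finset.mem_compl.1 hj (Finset.mem_filter.2 ⟨Finset.mem_univ j, h1⟩)
  have hU : mapZeroRows Tᶜ g * mapZeroRows T h = X ^ Fintype.card V := by
    rw [← mapZeroRows_univ_charpoly (G := G), hgh, map_mul, ← Finset.union_compl T,
      ← mapZeroRows_mapZeroRows T Tᶜ h, hhT, Finset.union_comm, ← mapZeroRows_mapZeroRows Tᶜ T g,
      hgT]
  rcases T.eq_empty_or_nonempty with hT | hT
  · right
    rw [hT, mapZeroRows_empty] at hU
    exact ⟨_, hU.symm.trans (mul_comm _ _)⟩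
  rcases Tᶜ.eq_empty_or_nonempty with hT' | hT'
  · left
    rw [hT', mapZeroRows_empty] at hU
    exact ⟨_, hU.symm⟩
  exfalso
  have h1 := mapZeroRows_charpoly (G := G) T
  have h2 := mapZeroRows_charpoly (G := G) Tᶜ
  rw [hgh, map_mul, hgT] at h1
  rw [hgh, map_mul, hhT] at h2
  -- Multiply χ = g h by `hU` and regroup: the four factors are exactly those of χ with the rows in
  -- `T`, respectively `Tᶜ`, set to zero.
  have h3 : (X : (MvPolynomial (Edge G) ℝ)[X]) ^ Fintype.card V * (genericLaplacian G).charpoly =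
      X ^ Fintype.card V * (principalCharpoly G T * principalCharpoly G Tᶜ) := by
    calc _ = (g * mapZeroRows T h) * (mapZeroRows Tᶜ g * h) := by rw [← hU, hgh]; ring
      _ = _ := by rw [h1, h2, ← Finset.card_add_card_compl T]; ring
  have h4 := congrArg (eval 0) (mul_left_cancel₀ (pow_ne_zero _ X_ne_zero) h3)
  rw [eval_zero_charpoly_genericLaplacian, eval_mul] at h4
  exact mul_ne_zero (eval_zero_principalCharpoly_ne_zero hG hconn hT)
    (eval_zero_principalCharpoly_ne_zero hG hconn hT') h4.symm

theorem not_X_dvd_principalCharpoly (hG : Loopless G) (hconn : StronglyConnected G)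
    {T : Finset V} (hT : T.Nonempty) : ¬ X ∣ principalCharpoly G T := by
  rw [X_dvd_iff, coeff_zero_eq_eval_zero]
  exact eval_zero_principalCharpoly_ne_zero hG hconn hT

theorem _root_.Polynomial.Monic.eq_one_or_X_dvd_of_dvd_X_pow {R : Type*} [CommRing R] [IsDomain R]
    {g : R[X]} (hg : g.Monic) {n : ℕ} (h : g ∣ X ^ n) : g = 1 ∨ X ∣ g := by
  obtain ⟨i, -, hi⟩ := (dvd_prime_pow prime_X n).1 h
  have := eq_of_monic_of_associated hg (monic_X_pow i) hi
  rcases Nat.eq_zero_or_pos i with h0 | h0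
  · left; rw [this, h0, pow_zero]
  · right; rw [this]; exact dvd_pow_self X h0.ne'

/-- A repeated factor divides a power of `X`, so X² would divide χ. Zeroing row `i` turns χ into X
χ_{i}, and χ_{i} has nonzero constant term. -/
theorem eq_one_of_mul_self_dvd_charpoly (hG : Loopless G) (hconn : StronglyConnected G)
    [Nonempty V] {g : (MvPolynomial (Edge G) ℝ)[X]} (hg : g.Monic)
    (h : g * g ∣ (genericLaplacian G).charpoly) : g = 1 := by
  obtain ⟨k, hk⟩ := h
  have h1 : g ∣ X ^ Fintype.card V := by
    rcases dvd_X_pow_or_dvd_X_pow hG hconn (hk.trans (mul_assoc g g k)) with h | h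
    · exact h
    · exact (dvd_mul_right g k).trans h
  refine (hg.eq_one_or_X_dvd_of_dvd_X_pow h1).resolve_right fun hX => ?_
  let i := Classical.arbitrary V
  apply not_X_dvd_principalCharpoly hG hconn (Finset.singleton_nonempty i)
  have h2 : X * X ∣ (genericLaplacian G).charpoly := hk ▸ (mul_dvd_mul hX hX).mul_right k
  have h3 := _root_.map_dvd (mapZeroRows {i}) h2
  rw [mapZeroRows_charpoly, Finset.card_singleton, pow_one, map_mul, coe_mapRingHom, map_X] at h3
  exact (mul_dvd_mul_iff_left X_ne_zero).1 h3

theorem eq_one_of_dvd_charpoly_of_dvd_principalCharpoly (hG : Loopless G)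
    (hconn : StronglyConnected G) (i : V) {g : (MvPolynomial (Edge G) ℝ)[X]} (hg : g.Monic)
    (h : g ∣ (genericLaplacian G).charpoly) (hi : g ∣ principalCharpoly G {i}) : g = 1 := by
  have : Nonempty V := ⟨i⟩
  obtain ⟨k, hk⟩ := h
  rcases dvd_X_pow_or_dvd_X_pow hG hconn hk with h | h
  · exact (hg.eq_one_or_X_dvd_of_dvd_X_pow h).resolve_right fun hX =>
      not_X_dvd_principalCharpoly hG hconn (Finset.singleton_nonempty i) (hX.trans hi)
  rcases ({i}ᶜ : Finset V).eq_empty_or_nonempty with hT | hT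
  · have : IsEmpty {j : V // j ∉ ({i} : Finset V)} :=
      ⟨fun j => by simpa [hT] using Finset.mem_compl.2 j.2⟩
    rw [principalCharpoly, Matrix.charpoly, Matrix.det_isEmpty] at hi
    exact hg.eq_one_of_isUnit (isUnit_of_dvd_one hi)
  exfalso
  -- Now the cofactor `k` divides a power of `X`. Zeroing all rows but `i` also sends `g` to a
  -- divisor of a power of `X`, so the linear polynomial χ_{{i}ᶜ} would have to be `X`.
  have h1 : mapZeroRows {i}ᶜ (principalCharpoly G {i}) ∣ X ^ Fintype.card V := by
    have := congrArg (mapZeroRows {i}ᶜ) (mapZeroRows_charpoly (G := G) {i})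
    rw [mapZeroRows_mapZeroRows, Finset.union_comm, Finset.union_compl,
      mapZeroRows_univ_charpoly, map_mul] at this
    exact ⟨_, this.trans (mul_comm _ _)⟩
  have h2 : principalCharpoly G {i}ᶜ ∣ X ^ (Fintype.card V + Fintype.card V) := by
    have h3 := mapZeroRows_charpoly (G := G) {i}ᶜ
    rw [hk, map_mul] at h3
    have h4 : mapZeroRows {i}ᶜ k ∣ X ^ Fintype.card V := by
      simpa only [map_pow, coe_mapRingHom, map_X] using
        _root_.map_dvd (mapZeroRows (G := G) {i}ᶜ) h
    refine (Dvd.intro_left _ h3.symm).trans ?_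
    rw [pow_add]
    exact mul_dvd_mul ((_root_.map_dvd _ hi).trans h1) h4
  rcases (principalCharpoly_monic _).eq_one_or_X_dvd_of_dvd_X_pow h2 with h3 | h3
  · have h4 := congrArg natDegree h3
    rw [principalCharpoly, Matrix.charpoly_natDegree_eq_dim, natDegree_one,
      Fintype.card_eq_zero_iff] at h4
    exact h4.false ⟨i, by simp⟩
  · exact not_X_dvd_principalCharpoly hG hconn hT h3

/-! ### Specialization and eigenvectors -/

/-- A nonzero polynomial in the edge weights off whose zero set the characteristic polynomial is
separable. -/
theorem exists_ne_zero_separable (hG : Loopless G) (hconn : StronglyConnected G) [Nonempty V] :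
    ∃ (a b : (MvPolynomial (Edge G) ℝ)[X]) (c : MvPolynomial (Edge G) ℝ), c ≠ 0 ∧
      a * (genericLaplacian G).charpoly + b * derivative (genericLaplacian G).charpoly = C c := by
  have h := separable_map_of_forall_monic (Matrix.charpoly_monic (genericLaplacian G))
    fun g hg => eq_one_of_mul_self_dvd_charpoly hG hconn hg
  rw [Separable, derivative_map] at h
  exact exists_mul_add_mul_eq_C_of_isCoprime_map h

theorem exists_ne_zero_isCoprime (hG : Loopless G) (hconn : StronglyConnected G) (i : V) :
    ∃ (a b : (MvPolynomial (Edge G) ℝ)[X]) (c : MvPolynomial (Edge G) ℝ), c ≠ 0 ∧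
      a * (genericLaplacian G).charpoly + b * principalCharpoly G {i} = C c :=
  exists_mul_add_mul_eq_C_of_isCoprime_map (isCoprime_map_of_forall_monic
    (Matrix.charpoly_monic _) fun _ hg =>
      eq_one_of_dvd_charpoly_of_dvd_principalCharpoly hG hconn i hg)

theorem isCoprime_map_of_mul_add_mul_eq_C {R K : Type*} [CommRing R] [Field K] (φ : R →+* K)
    {p q a b : R[X]} {c : R} (h : a * p + b * q = C c) (hc : φ c ≠ 0) :
    IsCoprime (p.map φ) (q.map φ) := by
  refine ⟨C (φ c)⁻¹ * a.map φ, C (φ c)⁻¹ * b.map φ, ?_⟩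
  have h1 := congrArg (Polynomial.map φ) h
  simp only [Polynomial.map_add, Polynomial.map_mul, map_C] at h1
  rw [mul_assoc, mul_assoc, ← mul_add, h1, ← C_mul, inv_mul_cancel₀ hc, C_1]

section Field

variable {K : Type*} [Field K]

/-- An eigenvector with a zero entry gives a common root of the characteristic polynomials of the
matrix and of a principal submatrix. -/
theorem entry_ne_zero_of_isCoprime_charpoly {A : Matrix V V K} {i : V}
    (h : IsCoprime A.charpoly
      (A.submatrix (Subtype.val : {j // j ∉ ({i} : Finset V)} → V) Subtype.val).charpoly)
    {μ : K} {v : V → K} (hv0 : v ≠ 0) (hv : A.mulVec v = μ • v) : v i ≠ 0 := by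
  intro hvi
  have hroot : ∀ {W : Type _} [Fintype W] [DecidableEq W] (B : Matrix W W K) (u : W → K), u ≠ 0 →
      B.mulVec u = μ • u → B.charpoly.eval μ = 0 := by
    intro W _ _ B u hu0 hu
    rw [Matrix.eval_charpoly, ← Matrix.exists_mulVec_eq_zero_iff]
    refine ⟨u, hu0, ?_⟩
    rw [Matrix.sub_mulVec, hu, sub_eq_zero, Matrix.scalar_apply]
    funext k
    simp [Matrix.mulVec_diagonal]
  obtain ⟨a, b, hab⟩ := h
  have h1 := congrArg (eval μ) hab
  rw [eval_add, eval_mul, eval_mul, hroot A v hv0 hv,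
    hroot _ (fun j : {j // j ∉ ({i} : Finset V)} => v j) ?_ ?_] at h1
  · simp at h1
  · intro h0
    apply hv0
    funext j
    by_cases hj : j = i
    · rw [hj, hvi, Pi.zero_apply]
    · exact congrFun h0 ⟨j, by simpa using hj⟩
  · funext j
    have h2 := congrFun hv j
    simp only [Matrix.mulVec, dotProduct, Matrix.submatrix_apply, Pi.smul_apply] at h2 ⊢
    rw [← h2, ← Fintype.sum_subtype_add_sum_subtype (fun k => k ∉ ({i} : Finset V)),
      left_eq_add]
    refine Finset.sum_eq_zero fun k _ => ?_
    have : k.1 = i := by simpa using k.2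
    rw [this, hvi, mul_zero]

end Field

theorem eigenvectorsNoZeroEntry_of_isCoprime {L : Matrix V V ℝ}
    (h : ∀ i : V, IsCoprime (L.map Complex.ofReal).charpoly ((L.map Complex.ofReal).submatrix
      (Subtype.val : {j // j ∉ ({i} : Finset V)} → V) Subtype.val).charpoly) :
    EigenvectorsNoZeroEntry L := by
  refine ⟨fun μ v hv i => ?_, fun μ v hv i => ?_⟩
  · exact entry_ne_zero_of_isCoprime_charpoly (h i) hv.2 hv.apply_eq_smul
  -- Left eigenvectors are right eigenvectors of the transpose, and both characteristic polynomials
  -- are invariant under transposition.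
  · refine entry_ne_zero_of_isCoprime_charpoly (A := (L.map Complex.ofReal).transpose) (μ := μ)
      ?_ hv.2 ?_
    · rw [Matrix.charpoly_transpose, ← Matrix.transpose_submatrix, Matrix.charpoly_transpose]
      exact h i
    · rw [Matrix.mulVec_transpose]
      exact hv.apply_eq_smul

theorem eigenvaluesSimple_of_separable {L : Matrix V V ℝ}
    (h : (L.map Complex.ofReal).charpoly.Separable) (hL : EigenvectorsNoZeroEntry L) :
    EigenvaluesSimple L := by
  intro μ hμ
  refine ⟨le_antisymm (rootMultiplicity_le_one_of_separable h μ) ?_, le_antisymm ?_ ?_⟩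
  · rw [Nat.one_le_iff_ne_zero, ← Nat.pos_iff_ne_zero,
      rootMultiplicity_pos (Matrix.charpoly_monic _).ne_zero]
    rw [Module.End.hasEigenvalue_iff_isRoot_charpoly] at hμ
    rwa [← Matrix.toLin'_apply', Matrix.charpoly_toLin'] at hμ
  · obtain ⟨v, hv⟩ := hμ.exists_hasEigenvector
    obtain ⟨i, -⟩ := Function.ne_iff.1 hv.2
    -- As no eigenvector has a zero entry, a single coordinate is injective on the eigenspace, which
    -- bounds its dimension by one.
    let f : Module.End.eigenspace (L.map Complex.ofReal).mulVecLin μ →ₗ[ℂ] ℂ :=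
      (LinearMap.proj i).comp (Submodule.subtype _)
    have hf : Function.Injective f := by
      rw [← LinearMap.ker_eq_bot, LinearMap.ker_eq_bot']
      intro u hu
      by_contra hu0
      exact hL.1 μ u ⟨u.2, fun h0 => hu0 (Subtype.ext h0)⟩ i hu
    simpa using LinearMap.finrank_le_finrank_of_injective hf
  · exact Submodule.one_le_finrank_iff.2 hμ

end WLM
end

/-! ### The main theorem -/

theorem theorem2 {V : Type*} [Fintype V] [DecidableEq V] (G : Digraph V)
    (hloop : WLM.Loopless G) (hconn : WLM.StronglyConnected G) :
    WLM.AlmostAll G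
      (fun L => WLM.EigenvectorsNoZeroEntry L ∧ WLM.EigenvaluesSimple L) := by
  classical
  rcases isEmpty_or_nonempty V with hV | hV
  · refine measure_mono_null (t := ∅) ?_ measure_empty
    rintro _ ⟨L, ⟨-, hL⟩, -⟩
    refine hL ⟨⟨fun _ _ _ i => isEmptyElim i, fun _ _ _ i => isEmptyElim i⟩, fun μ hμ => ?_⟩
    obtain ⟨v, hv⟩ := hμ.exists_hasEigenvector
    exact (hv.2 (Subsingleton.elim _ _)).elim
  obtain ⟨a, b, c, hc, habc⟩ := WLM.exists_ne_zero_separable hloop hconn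
  choose a' b' c' hc' habc' using WLM.exists_ne_zero_isCoprime hloop hconn
  -- One polynomial controls everything: the exceptional weights lie in the zero set of this
  -- product.
  have hd : c * ∏ i, c' i ≠ 0 := mul_ne_zero hc (Finset.prod_ne_zero_iff.2 fun i _ => hc' i)
  refine measure_mono_null ?_ (MvPolynomial.volume_setOf_eval_eq_zero _ hd)
  rintro _ ⟨L, ⟨hL, hbad⟩, rfl⟩
  rw [Set.mem_ofPred_eq]
  by_contra hne
  apply hbad
  rw [map_mul, map_prod] at hne
  let φ : MvPolynomial (WLM.Edge G) ℝ →+* ℂ :=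
    Complex.ofRealHom.comp (MvPolynomial.eval (WLM.edgeWeights G L))
  have hφ : (WLM.genericLaplacian G).map φ = L.map Complex.ofReal := by
    rw [← WLM.genericLaplacian_map_eval hloop hL]
    rfl
  have hφc : φ c ≠ 0 := by simpa [φ] using left_ne_zero_of_mul hne
  have hφc' : ∀ i, φ (c' i) ≠ 0 := fun i => by
    simpa [φ] using Finset.prod_ne_zero_iff.1 (right_ne_zero_of_mul hne) i (Finset.mem_univ i)
  have h1 : WLM.EigenvectorsNoZeroEntry L := by
    refine WLM.eigenvectorsNoZeroEntry_of_isCoprime fun i => ?_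
    have := WLM.isCoprime_map_of_mul_add_mul_eq_C φ (habc' i) (hφc' i)
    rwa [WLM.principalCharpoly, ← Matrix.charpoly_map, ← Matrix.charpoly_map,
      ← Matrix.submatrix_map, hφ] at this
  refine ⟨h1, WLM.eigenvaluesSimple_of_separable ?_ h1⟩
  have := WLM.isCoprime_map_of_mul_add_mul_eq_C φ habc hφc
  rwa [← Polynomial.derivative_map, ← Matrix.charpoly_map, hφ] at this
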